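/- Let $\mathbb B^2$ be the open unit ball of $\mathbb C^2$ and let $H^2_2$ be the two-variable Drury--Arveson space: the Hilbert space of power series $f(z)=\sum_{m,n\ge 0}c_{m,n}z_1^mz_2^n$ on $\mathbb B^2$ with $\|f\|^2=\sum_{m,n}\frac{m!\,n!}{(m+n)!}|c_{m,n}|^2<\infty$, whose reproducing kernel is $k(z,w)=\frac1{1-\langle z,w\rangle}$. A multiplier of $H^2_2$ is a function $\varphi$ on $\mathbb B^2$ with $\varphi f\in H^2_2$ for all $f\in H^2_2$. For $f\in H^2_2$ let $[f]$ be the smallest closed subspace of $H^2_2$ that contains $f$ and is invariant under multiplication by all multipliers, and for $h:\mathbb B^2\to\mathbb C$ put $\mathrm{Dom}\,h=\{f\in H^2_2: hf\in H^2_2\}$. Let $A^2(\mathbb D)$ be the Bergman space of holomorphic functions on the unit disk $\mathbb D$ that are square integrable with respect to area. **Proposition.** There exist functions $f_1,f_2\in H^2_2$ such that $f_1\in[f_2]$ and $h=f_1/f_2$ is holomorphic in $\mathbb B^2$ (that is, there is a holomorphic $h$ on $\mathbb B^2$ with $h=f_1/f_2$ wherever $f_2\neq0$, where $f_2\not\equiv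 0$), but $\mathrm{Dom}\,h$ is not dense in $H^2_2$. More precisely: there exist functions $g\in A^2(\mathbb D)$, $g\not\equiv0$, whose zeros $a$, counted with multiplicity, do not satisfy the Blaschke condition $\sum_a(1-|a|)<\infty$; and for every such $g$ the functions $f_1(z_1,z_2)=z_2\,g(z_1)$ and $f_2(z_1,z_2)=z_2$ belong to $H^2_2$ and have all the properties just listed. -/

import Mathlib

open Metric
open scoped lp ENNReal ComplexConjugate

noncomputable section

/-! ### Multiplication by functions in a Hilbert function space -/

section HilbertFunctionSpace

variable {X H : Type*} [NormedAddCommGroup H] [InnerProductSpace ℂ H] [RKHS ℂ H X ℂ]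

/-- `Dom h = {f ∈ H : h f ∈ H}`, the maximal domain of multiplication by `h : X → ℂ` in a Hilbert
function space `H` on `X`. -/
def multiplicationDomain (H : Type*) {X : Type*} [NormedAddCommGroup H] [InnerProductSpace ℂ H]
    [RKHS ℂ H X ℂ] (h : X → ℂ) : Set H :=
  {f | ∃ g : H, ∀ x, g x = h x * f x}

/-- `φ : X → ℂ` is a multiplier of `H` if `φ f ∈ H` for every `f ∈ H`. -/
def IsMultiplier (H : Type*) {X : Type*} [NormedAddCommGroup H] [InnerProductSpace ℂ H]
    [RKHS ℂ H X ℂ] (φ : X → ℂ) : Prop :=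
  ∀ f : H, ∃ g : H, ∀ x, g x = φ x * f x

/-- A subspace `M` of `H` is invariant under all multipliers of `H`. -/
def IsMultInvariant (M : Submodule ℂ H) : Prop :=
  ∀ φ : X → ℂ, IsMultiplier H φ → ∀ f ∈ M, ∀ g : H, (∀ x, g x = φ x * f x) → g ∈ M

/-- `[f]`, the smallest closed subspace of `H` that contains `f` and is invariant under all
multipliers of `H`. -/
def multInvariantSpan (f : H) : Submodule ℂ H :=
  sInf {M | IsClosed (M : Set H) ∧ IsMultInvariant M ∧ f ∈ M}

end HilbertFunctionSpace

/-! ### The two-variable Drury–Arveson space -/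

/-- The open unit ball of `ℂ²`. The coordinates of a point `z` are `z.1 0` and `z.1 1`. -/
abbrev UnitBall2 : Type := ball (0 : EuclideanSpace ℂ (Fin 2)) 1

/-- The Drury–Arveson space `H²_2`: power series `∑ c_{m,n} z₁ᵐ z₂ⁿ` with
`∑ |c_{m,n}|² m! n! / (m+n)! < ∞`, where the square of the norm is this sum.
An element is stored through its coordinates in the orthonormal basis
`√((m+n)! / (m! n!)) z₁ᵐ z₂ⁿ`; the associated function on the ball is given by the `RKHS`
instance below, see `DruryArveson2.hasSum_apply`. -/
def DruryArveson2 : Type := ℓ²(ℕ × ℕ, ℂ)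

namespace DruryArveson2

instance : NormedAddCommGroup DruryArveson2 := inferInstanceAs (NormedAddCommGroup ℓ²(ℕ × ℕ, ℂ))
instance : InnerProductSpace ℂ DruryArveson2 := inferInstanceAs (InnerProductSpace ℂ ℓ²(ℕ × ℕ, ℂ))
instance : CompleteSpace DruryArveson2 := inferInstanceAs (CompleteSpace ℓ²(ℕ × ℕ, ℂ))

/-- The square-summable family of the coordinates of `f`. -/
def toL2 (f : DruryArveson2) : ℓ²(ℕ × ℕ, ℂ) := f

/-- The coordinates of `f` in the basis `basisFun`. -/
def coeff (f : DruryArveson2) (p : ℕ × ℕ) : ℂ := f.toL2 p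

/-- The function `√((m+n)! / (m! n!)) z₁ᵐ z₂ⁿ`. -/
def basisFun (p : ℕ × ℕ) (z : UnitBall2) : ℂ :=
  (Real.sqrt ((p.1 + p.2).choose p.1) : ℂ) * (z.1 0 ^ p.1 * z.1 1 ^ p.2)

lemma norm_coord_sq (z : UnitBall2) : ‖z.1 0‖ ^ 2 + ‖z.1 1‖ ^ 2 < 1 := by
  have h := z.2
  rw [mem_ball_zero_iff, EuclideanSpace.norm_eq, Real.sqrt_lt' one_pos] at h
  simpa [Fin.sum_univ_two] using h

/-- `∑_{m,n} ((m+n)! / (m! n!)) aᵐ bⁿ = 1 / (1 - (a + b))`. -/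
lemma hasSum_choose {a b : ℂ} (h : ‖a‖ + ‖b‖ < 1) :
    HasSum (fun p : ℕ × ℕ => ((p.1 + p.2).choose p.1 : ℂ) * (a ^ p.1 * b ^ p.2))
      (1 - (a + b))⁻¹ := by
  have key : ∀ {R : Type} [NormedField R] (a b : R) (n : ℕ),
      ∑ q : Finset.HasAntidiagonal.antidiagonal n, ((q.1.1 + q.1.2).choose q.1.1 : R) * (a ^ q.1.1 * b ^ q.1.2)
        = (a + b) ^ n := by
    intro R _ a b n
    rw [Finset.sum_coe_sort (Finset.HasAntidiagonal.antidiagonal n)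
      (fun q : ℕ × ℕ => ((q.1 + q.2).choose q.1 : R) * (a ^ q.1 * b ^ q.2)),
      (Commute.all a b).add_pow']
    refine Finset.sum_congr rfl fun q hq => ?_
    rw [Finset.HasAntidiagonal.mem_antidiagonal.1 hq, nsmul_eq_mul]
  have hs : Summable (fun p : ℕ × ℕ => ((p.1 + p.2).choose p.1 : ℂ) * (a ^ p.1 * b ^ p.2)) := by
    rw [← Finset.HasAntidiagonal.sigmaAntidiagonalEquivProd.summable_iff]
    refine Summable.of_norm ?_
    rw [summable_sigma_of_nonneg (fun _ => norm_nonneg _)]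
    refine ⟨fun n => (hasSum_fintype _).summable, ?_⟩
    refine (summable_geometric_of_lt_one (by positivity) h).congr fun n => ?_
    rw [tsum_fintype, ← key]
    simp [Finset.HasAntidiagonal.sigmaAntidiagonalEquivProd]
  have hab : ‖a + b‖ < 1 := (norm_add_le a b).trans_lt h
  have h1 := (Finset.HasAntidiagonal.sigmaAntidiagonalEquivProd.summable_iff.2 hs).hasSum
  have h2 := h1.sigma (fun n => hasSum_fintype _)
  have h3 := hasSum_geometric_of_norm_lt_one hab
  rw [← Finset.HasAntidiagonal.sigmaAntidiagonalEquivProd.hasSum_iff]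
  convert! h1
  refine h3.unique ?_
  convert! h2 with n
  exact (key a b n).symm

lemma memℓp_basisFun (z : UnitBall2) : Memℓp (fun p => conj (basisFun p z)) 2 := by
  refine memℓp_gen ?_
  have h := hasSum_choose (a := ((‖z.1 0‖ ^ 2 : ℝ) : ℂ)) (b := ((‖z.1 1‖ ^ 2 : ℝ) : ℂ))
    (by simpa using norm_coord_sq z)
  refine h.summable.norm.congr fun p => ?_
  simp [basisFun, mul_pow, ← pow_mul, mul_comm]

/-- The vector that represents the evaluation at `z`. -/
def kernelVec (z : UnitBall2) : DruryArveson2 :=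
  (⟨fun p => conj (basisFun p z), memℓp_basisFun z⟩ : ℓ²(ℕ × ℕ, ℂ))

lemma hasSum_inner_kernelVec (f : DruryArveson2) (z : UnitBall2) :
    HasSum (fun p => f.coeff p * basisFun p z) (inner ℂ (kernelVec z) f) := by
  have e : (fun p => f.coeff p * basisFun p z)
      = fun p => inner ℂ ((kernelVec z).toL2 p) (f.toL2 p) := by
    funext p
    change _ = f.coeff p * conj (conj (basisFun p z))
    rw [Complex.conj_conj]
  rw [e]
  exact lp.hasSum_inner (𝕜 := ℂ) (kernelVec z).toL2 f.toL2

lemma eq_zero_of_hasSum {a : ℕ → ℂ} {r : ℝ} (hr : 0 < r)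
    (h : ∀ z : ℂ, ‖z‖ < r → HasSum (fun n => a n * z ^ n) 0) (n : ℕ) : a n = 0 := by
  have hp : HasFPowerSeriesAt (0 : ℂ → ℂ) (FormalMultilinearSeries.ofScalars ℂ a) 0 := by
    rw [hasFPowerSeriesAt_iff]
    filter_upwards [ball_mem_nhds (0 : ℂ) hr] with z hz
    simpa [FormalMultilinearSeries.coeff_ofScalars, mul_comm] using h z (by simpa using hz)
  have := congrArg (fun p => p.coeff n) hp.eq_zero
  simp only [FormalMultilinearSeries.coeff_ofScalars] at this
  exact this

/-- The point of the ball with given small coordinates. -/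
lemma exists_point {x y : ℂ} (hx : ‖x‖ < 1 / 2) (hy : ‖y‖ < 1 / 2) :
    ∃ z : UnitBall2, z.1 0 = x ∧ z.1 1 = y := by
  refine ⟨⟨!₂[x, y], ?_⟩, by simp, by simp⟩
  rw [mem_ball_zero_iff, EuclideanSpace.norm_eq, Real.sqrt_lt' one_pos]
  simp only [Fin.sum_univ_two, Matrix.cons_val_zero, Matrix.cons_val_one, one_pow]
  nlinarith [norm_nonneg x, norm_nonneg y]

/-- A function in `H²_2` determines its power series. -/
lemma eq_zero_of_inner_kernelVec (f : DruryArveson2) (h : ∀ z, inner ℂ (kernelVec z) f = 0) :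
    f = 0 := by
  have hc : ∀ m n, f.coeff (m, n) * (Real.sqrt ((m + n).choose m) : ℂ) = 0 := by
    have hxy : ∀ x y : ℂ, ‖x‖ < 1 / 2 → ‖y‖ < 1 / 2 → HasSum (fun p : ℕ × ℕ =>
        f.coeff p * (Real.sqrt ((p.1 + p.2).choose p.1) : ℂ) * y ^ p.2 * x ^ p.1) 0 := by
      intro x y hx hy
      obtain ⟨z, rfl, rfl⟩ := exists_point hx hy
      rw [← h z]
      convert! hasSum_inner_kernelVec f z using 2
      simp only [basisFun]
      ring
    intro m n
    refine eq_zero_of_hasSum (r := 1 / 2)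
      (a := fun n => f.coeff (m, n) * (Real.sqrt ((m + n).choose m) : ℂ)) one_half_pos
      (fun y hy => ?_) n
    have hs : ∀ m, Summable fun n : ℕ =>
        f.coeff (m, n) * (Real.sqrt ((m + n).choose m) : ℂ) * y ^ n := by
      intro m
      have := (hxy (1 / 4) y (by norm_num) hy).summable.prod_factor m
      refine (this.mul_right ((4 : ℂ) ^ m)).congr fun n => ?_
      simp only [mul_assoc]
      rw [← mul_pow]
      norm_num
    refine (hs m).hasSum_iff.2 ?_
    refine eq_zero_of_hasSum (r := 1 / 2) (a := fun m => ∑' n, f.coeff (m, n) *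
      (Real.sqrt ((m + n).choose m) : ℂ) * y ^ n) one_half_pos (fun x hx => ?_) m
    refine HasSum.prod_fiberwise (hxy x y hx hy) fun m => ?_
    exact HasSum.mul_right (x ^ m) (hs m).hasSum
  refine lp.ext (funext fun p => ?_)
  have hne : (Real.sqrt ((p.1 + p.2).choose p.1) : ℂ) ≠ 0 := by
    have : (0 : ℝ) < (p.1 + p.2).choose p.1 := by
      exact_mod_cast Nat.choose_pos (Nat.le_add_right _ _)
    exact_mod_cast (Real.sqrt_pos.2 this).ne'
  exact (mul_eq_zero.1 (hc p.1 p.2)).resolve_right hne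

/-- `H²_2` as a Hilbert space of functions on the ball. -/
instance : RKHS ℂ DruryArveson2 UnitBall2 ℂ where
  coeCLM := ContinuousLinearMap.pi fun z => innerSL ℂ (kernelVec z)
  coeCLM_injective := by
    intro f g hfg
    refine sub_eq_zero.1 (eq_zero_of_inner_kernelVec _ fun z => ?_)
    rw [inner_sub_right, sub_eq_zero]
    exact congrFun hfg z

/-- `f(z) = ∑ c_{m,n} √((m+n)! / (m! n!)) z₁ᵐ z₂ⁿ`. -/
lemma hasSum_apply (f : DruryArveson2) (z : UnitBall2) :
    HasSum (fun p => f.coeff p * basisFun p z) (f z) :=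
  hasSum_inner_kernelVec f z

lemma hasSum_norm_sq (f : DruryArveson2) : HasSum (fun p => ‖f.coeff p‖ ^ 2) (‖f‖ ^ 2) := by
  have := lp.hasSum_norm (p := 2) (by norm_num) f.toL2
  simp only [ENNReal.toReal_ofNat, Real.rpow_ofNat] at this
  exact this

/-- The reproducing kernel of `H²_2` is `k(z, w) = 1 / (1 - ⟨z, w⟩)`. -/
lemma kernel_eq (z w : UnitBall2) :
    RKHS.kernel DruryArveson2 z w 1 = (1 - (z.1 0 * conj (w.1 0) + z.1 1 * conj (w.1 1)))⁻¹ := by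
  have hw : RKHS.kerFun DruryArveson2 w (1 : ℂ) = kernelVec w := by
    refine ext_inner_right ℂ fun f => ?_
    rw [RKHS.kerFun_inner]
    have hf : f w = inner ℂ (kernelVec w) f := rfl
    rw [← hf]
    simp
  rw [← RKHS.kerFun_apply, hw]
  refine (hasSum_apply (kernelVec w) z).unique ?_
  convert! hasSum_choose (a := z.1 0 * conj (w.1 0)) (b := z.1 1 * conj (w.1 1)) ?_ using 2 with p
  · have : (Real.sqrt ((p.1 + p.2).choose p.1) : ℂ) * (Real.sqrt ((p.1 + p.2).choose p.1) : ℂ)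
        = ((p.1 + p.2).choose p.1 : ℂ) := by
      rw [← Complex.ofReal_mul, Real.mul_self_sqrt (by positivity)]
      simp
    rw [← this]
    simp only [coeff, toL2, kernelVec, basisFun, map_mul, map_pow, Complex.conj_ofReal]
    ring
  · simp only [norm_mul, RCLike.norm_conj]
    nlinarith [norm_coord_sq z, norm_coord_sq w, sq_nonneg (‖z.1 0‖ - ‖w.1 0‖),
      sq_nonneg (‖z.1 1‖ - ‖w.1 1‖)]

end DruryArveson2

/-! ### The Bergman space and the Blaschke condition in the unit disk -/

/-- `g` belongs to the Bergman space `A²(𝔻)`: it is holomorphic in the unit disk and square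
integrable there with respect to area. Only the values of `g` in the disk matter. -/
def MemBergman (g : ℂ → ℂ) : Prop :=
  DifferentiableOn ℂ g (ball 0 1) ∧
    MeasureTheory.MemLp g 2 (MeasureTheory.volume.restrict (ball 0 1))

/-- The zeros of `g` in the unit disk, counted with multiplicity, satisfy the Blaschke condition
`∑ (1 - |a|) < ∞`. For a holomorphic `g ≢ 0`, the terms of this sum vanish off the zeros. -/
def BlaschkeZeros (g : ℂ → ℂ) : Prop :=
  Summable fun a : ball (0 : ℂ) 1 => (analyticOrderNatAt g a : ℝ) * (1 - ‖(a : ℂ)‖)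

end

/-!
On the disc `z₂ = 0` a function of `H²_2` restricts to a function of the Hardy space `H²(𝔻)`, because
`z₁ᵐ` has norm one in `H²_2`. If `f` and `g(z₁) f` are both in `H²_2`, then `f(·, 0)` and
`g · f(·, 0)` are in `H²(𝔻)`; when `f(·, 0) ≢ 0`, the zeros of the latter satisfy the Blaschke
condition, hence so do those of `g`. So if the zeros of `g` are not Blaschke, every function in
`Dom g(z₁)` vanishes on the disc, and the domain is not dense since evaluation at the origin is a
nonzero continuous functional: `apply_discPoint_eq_zero_of_mem_multiplicationDomain`. The Blaschke
condition for `H²(𝔻)` comes from Jensen's formula, where `log x ≤ x² / 2` bounds the mean of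
`log ‖F‖` by the mean of `‖F‖²`, which Parseval's identity bounds by the norm.

In contrast, `z₁ᵐ z₂` has norm `1 / √(m + 1)`, so that `z₂ g(z₁)` is in `H²_2` exactly when
`∑ |aₘ|² / (m + 1) < ∞` for the Taylor coefficients `aₘ` of `g`. By Parseval on circles and polar
coordinates this is the Bergman condition (`lintegral_ball_enorm_sq`). The expansion
`∑ aₘ z₁ᵐ z₂` converges in `H²_2`, and since `z₁` is a multiplier all its terms are in `[z₂]`.

A Bergman function with non-Blaschke zeros is the product `∏ (1 - 2 z ^ nₖ)` with `nₖ = 100 ^ k`.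
On the disk its first `k` factors have product at most `3 ^ k`, and `z ^ nₖ` has Bergman norm at
most `√π / 10 ^ k`, so the partial products are bounded in the Bergman norm. The `k`-th factor has
`nₖ` zeros of modulus `x` with `x ^ nₖ = 1 / 2`, and `nₖ (1 - x) ≥ 1 / 2` by Bernoulli's inequality,
so that each factor adds at least `1 / 2` to the Blaschke sum.
-/

noncomputable section

/-! ### Parseval's identity on circles and the Bergman norm -/

open Real in
lemma integral_circleMap_pow_mul_conj (r : ℝ) (m n : ℕ) :
    ∫ θ in (0 : ℝ)..2 * π, circleMap 0 r θ ^ m * conj (circleMap 0 r θ ^ n)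
      = if m = n then 2 * π * (r : ℂ) ^ (2 * m) else 0 := by
  have e : ∀ θ : ℝ, circleMap 0 r θ ^ m * conj (circleMap 0 r θ ^ n)
      = (r : ℂ) ^ (m + n) * Complex.exp (((m : ℂ) - n) * Complex.I * θ) := by
    intro θ
    simp only [circleMap, zero_add, mul_pow, map_mul, map_pow, Complex.conj_ofReal,
      ← Complex.exp_conj, ← Complex.exp_nat_mul, Complex.conj_I, map_natCast]
    rw [mul_mul_mul_comm, ← pow_add, ← Complex.exp_add]
    congr 2
    ring
  simp only [e]
  rw [intervalIntegral.integral_const_mul]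
  split_ifs with h
  · subst h
    simp [two_mul]
    ring
  · have h0 : ((m : ℂ) - n) * Complex.I ≠ 0 :=
      mul_ne_zero (sub_ne_zero.2 (by exact_mod_cast h)) Complex.I_ne_zero
    rw [integral_exp_mul_complex h0]
    have : Complex.exp (((m : ℂ) - n) * Complex.I * ((2 * π : ℝ) : ℂ)) = 1 := by
      rw [Complex.exp_eq_one_iff]
      exact ⟨(m : ℤ) - n, by push_cast; ring⟩
    rw [this]
    simp

open Real in
/-- Parseval's identity on the circle of radius `r` for an absolutely convergent power series. -/
lemma hasSum_circleAverage_norm_sq {a : ℕ → ℂ} {f : ℂ → ℂ} {r : ℝ} (hr : 0 ≤ r)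
    (ha : Summable fun n => ‖a n‖ * r ^ n)
    (hf : ∀ z : ℂ, ‖z‖ = r → HasSum (fun n => a n * z ^ n) (f z)) :
    HasSum (fun n => ‖a n‖ ^ 2 * r ^ (2 * n)) (circleAverage (fun z => ‖f z‖ ^ 2) 0 r) := by
  have hnorm : ∀ θ, ‖circleMap 0 r θ‖ = r := fun θ => by simp [abs_of_nonneg hr]
  -- Expand `|f|² = f · conj f` as a double series on the circle and integrate it term by term;
  -- only the diagonal terms survive.
  let F : ℕ × ℕ → ℝ → ℂ := fun p θ =>
    (a p.1 * circleMap 0 r θ ^ p.1) * conj (a p.2 * circleMap 0 r θ ^ p.2)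
  have hsn : Summable fun p : ℕ × ℕ => (‖a p.1‖ * r ^ p.1) * (‖a p.2‖ * r ^ p.2) :=
    ha.mul_of_nonneg ha (fun n => by positivity) (fun n => by positivity)
  have hFn : ∀ p θ, ‖F p θ‖ = (‖a p.1‖ * r ^ p.1) * (‖a p.2‖ * r ^ p.2) := by
    intro p θ
    simp [F, abs_of_nonneg hr]
  have hpt : ∀ θ : ℝ, HasSum (fun p => F p θ) (((‖f (circleMap 0 r θ)‖ ^ 2 : ℝ) : ℂ)) := by
    intro θ
    have h1 := hf _ (hnorm θ)
    have h2 := Complex.hasSum_conj'.2 h1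
    have := h1.mul h2 (Summable.of_norm (hsn.congr fun p => (hFn p θ).symm))
    rwa [Complex.mul_conj, Complex.normSq_eq_norm_sq] at this
  have hint := intervalIntegral.hasSum_integral_of_dominated_convergence (μ := MeasureTheory.volume)
    (a := 0) (b := 2 * π) (F := F) (f := fun θ => ((‖f (circleMap 0 r θ)‖ ^ 2 : ℝ) : ℂ))
    (fun p _ => (‖a p.1‖ * r ^ p.1) * (‖a p.2‖ * r ^ p.2))
    (fun p => by
      apply Continuous.aestronglyMeasurable
      fun_prop)
    (fun p => by simp [hFn])
    (by simp [hsn])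
    (by simp)
    (MeasureTheory.ae_of_all _ fun θ _ => hpt θ)
  have hval : ∀ p : ℕ × ℕ, ∫ θ in (0 : ℝ)..2 * π, F p θ
      = if p.1 = p.2 then ((2 * π * (‖a p.1‖ ^ 2 * r ^ (2 * p.1)) : ℝ) : ℂ) else 0 := by
    rintro ⟨m, n⟩
    have : ∀ θ, F (m, n) θ
        = (a m * conj (a n)) * (circleMap 0 r θ ^ m * conj (circleMap 0 r θ ^ n)) := by
      intro θ
      simp only [F, map_mul]
      ring
    simp only [this, intervalIntegral.integral_const_mul, integral_circleMap_pow_mul_conj]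
    split_ifs with h
    · subst h
      rw [Complex.mul_conj, Complex.normSq_eq_norm_sq]
      push_cast
      ring
    · simp
  simp only [hval] at hint
  have hinj : Function.Injective fun n : ℕ => (n, n) := fun m n h => (Prod.ext_iff.1 h).1
  rw [← hinj.hasSum_iff] at hint
  · rw [intervalIntegral.integral_ofReal] at hint
    simp only [Function.comp_def, if_true] at hint
    rw [Complex.hasSum_ofReal] at hint
    have := hint.mul_left (2 * π)⁻¹
    rw [circleAverage_def, smul_eq_mul]
    refine this.congr_fun fun n => ?_
    field_simp
  · rintro ⟨m, n⟩ h
    have : m ≠ n := fun e => h ⟨m, by simp [e]⟩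
    simp [this]

open Real MeasureTheory in
lemma lintegral_circleMap_enorm_sq {f : ℂ → ℂ} {r : ℝ} (hf : ContinuousOn f (sphere 0 |r|)) :
    ∫⁻ θ in Set.Ioo (-π) π, ‖f (circleMap 0 r θ)‖ₑ ^ 2
      = ENNReal.ofReal (2 * π * circleAverage (fun z => ‖f z‖ ^ 2) 0 r) := by
  have hc : Continuous fun θ : ℝ => ‖f (circleMap 0 r θ)‖ ^ 2 :=
    ((hf.comp_continuous (continuous_circleMap 0 r)
      (circleMap_mem_sphere' 0 r)).norm).pow 2
  have h1 : 2 * π * circleAverage (fun z => ‖f z‖ ^ 2) 0 r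
      = ∫ θ in Set.Ioo (-π) π, ‖f (circleMap 0 r θ)‖ ^ 2 := by
    rw [circleAverage_eq_integral_add (-π),
      intervalIntegral.integral_comp_add_right (fun θ => ‖f (circleMap 0 r θ)‖ ^ 2),
      ← integral_Ioc_eq_integral_Ioo, ← intervalIntegral.integral_of_le (by linarith [pi_pos]),
      smul_eq_mul]
    field_simp
    congr 1 <;> ring
  rw [h1, ofReal_integral_eq_lintegral_ofReal]
  · refine lintegral_congr fun θ => ?_
    rw [ENNReal.ofReal_pow (norm_nonneg _), ofReal_norm]
  · exact (hc.integrableOn_Icc (a := -π) (b := π)).mono_set Set.Ioo_subset_Icc_self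
  · exact ae_of_all _ fun θ => by positivity

lemma summable_norm_mul_pow {a : ℕ → ℂ} {f : ℂ → ℂ}
    (hf : ∀ z : ℂ, ‖z‖ < 1 → HasSum (fun n => a n * z ^ n) (f z)) {r : ℝ} (h0 : 0 ≤ r)
    (h1 : r < 1) : Summable fun n => ‖a n‖ * r ^ n := by
  have := (hf r (by simpa [abs_of_nonneg h0])).summable.norm
  simpa [abs_of_nonneg h0] using this

open Real MeasureTheory in
/-- The square of the Bergman norm in terms of the Taylor coefficients. -/
lemma lintegral_ball_enorm_sq {a : ℕ → ℂ} {f : ℂ → ℂ} (hc : ContinuousOn f (ball 0 1))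
    (hf : ∀ z : ℂ, ‖z‖ < 1 → HasSum (fun n => a n * z ^ n) (f z)) :
    ∫⁻ z in ball (0 : ℂ) 1, ‖f z‖ₑ ^ 2 = ∑' n : ℕ, ENNReal.ofReal (π * (‖a n‖ ^ 2 / (n + 1))) := by
  have hm : Measurable ((ball (0 : ℂ) 1).indicator fun z => ‖f z‖ₑ ^ 2) := by
    classical
    rw [← Set.piecewise_eq_indicator]
    exact ContinuousOn.measurable_piecewise
      ((ENNReal.continuous_pow 2).comp_continuousOn hc.enorm) continuousOn_const measurableSet_ball
  have hpm : Measurable fun p : ℝ × ℝ => Complex.polarCoord.symm p := by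
    simp only [Complex.polarCoord_symm_apply]
    fun_prop
  rw [← lintegral_indicator measurableSet_ball, ← Complex.lintegral_comp_polarCoord_symm,
    polarCoord_target, Measure.volume_eq_prod, ← Measure.prod_restrict, lintegral_prod]
  swap
  · exact ((ENNReal.measurable_ofReal.comp measurable_fst).smul (hm.comp hpm)).aemeasurable
  have hin : ∀ r ∈ Set.Ioi (0 : ℝ), ∫⁻ θ in Set.Ioo (-π) π, ENNReal.ofReal r •
      (ball (0 : ℂ) 1).indicator (fun z => ‖f z‖ₑ ^ 2) (Complex.polarCoord.symm (r, θ))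
      = (Set.Iio (1 : ℝ)).indicator (fun r => ∑' n : ℕ,
          ENNReal.ofReal (2 * π * ‖a n‖ ^ 2 * r ^ (2 * n + 1))) r := by
    intro r hr
    have hr0 : 0 < r := hr
    have hp : ∀ θ : ℝ, Complex.polarCoord.symm (r, θ) = circleMap 0 r θ := by
      intro θ
      simp [Complex.polarCoord_symm_apply, circleMap, Complex.exp_mul_I]
    have hn : ∀ θ, ‖circleMap 0 r θ‖ = r := fun θ => by simp [abs_of_pos hr0]
    simp only [hp]
    by_cases h1 : r < 1
    · have hs := hasSum_circleAverage_norm_sq hr0.le (summable_norm_mul_pow hf hr0.le h1)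
        (fun z hz => hf z (hz ▸ h1))
      rw [Set.indicator_of_mem (by exact h1)]
      simp only [smul_eq_mul, Set.indicator_of_mem (mem_ball_zero_iff.2 ((hn _).trans_lt h1))]
      rw [lintegral_const_mul' _ _ ENNReal.ofReal_ne_top, lintegral_circleMap_enorm_sq
        (hc.mono fun z hz => by simpa [abs_of_pos hr0, mem_sphere_zero_iff_norm.1 hz] using
          (mem_sphere_zero_iff_norm.1 hz).trans_lt (by rwa [abs_of_pos hr0])),
        ← ENNReal.ofReal_mul hr0.le, ← hs.tsum_eq, ← tsum_mul_left, ← tsum_mul_left,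
        ENNReal.ofReal_tsum_of_nonneg]
      · refine tsum_congr fun n => ?_
        congr 1
        ring
      · intro n; positivity
      · exact (hs.summable.mul_left _).mul_left _
    · rw [Set.indicator_of_notMem (by exact h1)]
      simp only [Set.indicator_of_notMem (s := ball (0 : ℂ) 1) (a := circleMap 0 r _)
        (by simpa [abs_of_pos hr0] using h1)]
      simp
  rw [setLIntegral_congr_fun measurableSet_Ioi hin, ← lintegral_indicator measurableSet_Ioi,
    Set.indicator_indicator, lintegral_indicator (measurableSet_Ioi.inter measurableSet_Iio),
    Set.Ioi_inter_Iio, lintegral_tsum (fun n => by fun_prop)]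
  refine tsum_congr fun n => ?_
  rw [← ofReal_integral_eq_lintegral_ofReal, integral_const_mul, ← integral_Ioc_eq_integral_Ioo,
    ← intervalIntegral.integral_of_le zero_le_one, integral_pow]
  · congr 1
    push_cast
    field_simp
    simp
    ring
  · refine (Continuous.integrableOn_Icc (a := 0) (b := 1) (by fun_prop)).mono_set
      Set.Ioo_subset_Icc_self
  · filter_upwards [ae_restrict_mem measurableSet_Ioo] with r hr
    have := hr.1
    positivity

open MeasureTheory in
lemma eLpNorm_two_sq (f : ℂ → ℂ) :
    eLpNorm f 2 (volume.restrict (ball 0 1)) ^ 2 = ∫⁻ z in ball (0 : ℂ) 1, ‖f z‖ₑ ^ 2 := by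
  rw [eLpNorm_eq_lintegral_rpow_enorm_toReal (by norm_num) (by norm_num)]
  rw [← ENNReal.rpow_natCast, ← ENNReal.rpow_mul]
  norm_num

open MeasureTheory in
/-- The Taylor coefficients `aₙ` of a function in the Bergman space satisfy
`∑ |aₙ|² / (n + 1) < ∞`. -/
lemma MemBergman.exists_hasSum {g : ℂ → ℂ} (hg : MemBergman g) :
    ∃ a : ℕ → ℂ, (∀ z : ℂ, ‖z‖ < 1 → HasSum (fun n => a n * z ^ n) (g z)) ∧
      Summable fun n : ℕ => ‖a n‖ ^ 2 / (n + 1) := by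
  have ha : ∀ z : ℂ, ‖z‖ < 1 →
      HasSum (fun n : ℕ => ((n.factorial : ℂ)⁻¹ * iteratedDeriv n g 0) * z ^ n) (g z) := by
    intro z hz
    have := Complex.hasSum_taylorSeries_on_ball hg.1 (mem_ball_zero_iff.2 hz)
    refine this.congr_fun fun n => ?_
    simp only [sub_zero, smul_eq_mul]
    ring
  refine ⟨_, ha, ?_⟩
  have h := lintegral_ball_enorm_sq hg.1.continuousOn ha
  have hlt : ∫⁻ z in ball (0 : ℂ) 1, ‖g z‖ₑ ^ 2 ≠ ⊤ := by
    rw [← eLpNorm_two_sq]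
    exact ENNReal.pow_ne_top hg.2.2.ne
  rw [h] at hlt
  have hs := (ENNReal.summable_toReal hlt).mul_left Real.pi⁻¹
  refine hs.congr fun n => ?_
  rw [ENNReal.toReal_ofReal (by positivity)]
  field_simp


/-! ### Jensen's formula and the Blaschke condition -/

open Real Filter Topology in

/-- The zeros of a holomorphic function with bounded quadratic means are Blaschke. Jensen's formula
bounds `∑ log (r / |a|)` over the nonzero zeros `a` with `|a| ≤ r`, and `1 - |a| / r ≤ log (r / |a|)`;
then `r → 1`. -/
lemma blaschkeZeros_of_circleAverage_le {F : ℂ → ℂ} (hF : DifferentiableOn ℂ F (ball 0 1))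
    (hne : ∀ z ∈ ball (0 : ℂ) 1, analyticOrderAt F z ≠ ⊤) {S : ℝ}
    (hS : ∀ r : ℝ, 0 ≤ r → r < 1 → circleAverage (fun z => ‖F z‖ ^ 2) 0 r ≤ S) :
    BlaschkeZeros F := by
  have hA : AnalyticOnNhd ℂ F (ball 0 1) := hF.analyticOnNhd isOpen_ball
  let k : ℝ := (analyticOrderNatAt F 0 : ℕ)
  set L : ℝ := log ‖meromorphicTrailingCoeffAt F 0‖
  let o : ball (0 : ℂ) 1 → ℝ := fun a => analyticOrderNatAt F a
  refine summable_of_sum_le (c := k + (S / 2 - L)) (fun a => mul_nonneg (Nat.cast_nonneg _)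
    (sub_nonneg.2 (mem_ball_zero_iff.1 a.2).le)) fun T => ?_
  have key : ∀ᶠ r in 𝓝[<] (1 : ℝ), ∑ a ∈ T, o a * (1 - ‖(a : ℂ)‖ / r)
      ≤ k + (S / 2 - L - k * log r) := by
    have hT : ∀ᶠ r in 𝓝[<] (1 : ℝ), ∀ a ∈ T, ‖(a : ℂ)‖ < r :=
      (Finset.eventually_all T).2 fun a _ =>
        (eventually_gt_nhds (mem_ball_zero_iff.1 a.2)).filter_mono nhdsWithin_le_nhds
    have hpos : ∀ᶠ r in 𝓝[<] (1 : ℝ), 0 < r :=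
      (eventually_gt_nhds one_pos).filter_mono nhdsWithin_le_nhds
    filter_upwards [hT, hpos, self_mem_nhdsWithin] with r hTr hr0 hr1
    have hr1 : r < 1 := hr1
    have hsub : closedBall (0 : ℂ) r ⊆ ball 0 1 := closedBall_subset_ball hr1
    have hAr : AnalyticOnNhd ℂ F (closedBall 0 |r|) := by
      rw [abs_of_pos hr0]
      exact hA.mono hsub
    have hmer := hAr.meromorphicOn
    have hmS : MeromorphicOn F (sphere 0 |r|) := fun z hz => hmer z (sphere_subset_closedBall hz)
    set D := MeromorphicOn.divisor F (closedBall 0 |r|)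
    have hD : ∀ u, ‖u‖ ≤ r → (D u : ℝ) = analyticOrderNatAt F u := by
      intro u hu
      have hu' : u ∈ closedBall (0 : ℂ) |r| := by simpa [abs_of_pos hr0] using hu
      have h1 := MeromorphicOn.AnalyticOnNhd.divisor_apply hAr hu'
      have h2 := Nat.cast_analyticOrderNatAt
        (hne u (mem_ball_zero_iff.2 (hu.trans_lt hr1)))
      rw [← h2] at h1
      change D u = _ at h1
      rw [h1]
      rfl
    -- `log x ≤ x² / 2`, so no convexity inequality is needed to bound the mean of `log ‖F‖`.
    have hmean : circleAverage (fun z => log ‖F z‖) 0 r ≤ S / 2 := by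
      have hcont : ContinuousOn F (sphere 0 |r|) := fun z hz =>
        (hAr z (sphere_subset_closedBall hz)).continuousAt.continuousWithinAt
      have h1 : circleAverage (fun z => log ‖F z‖) 0 r
          ≤ circleAverage (fun z => (1 / 2 : ℝ) • ‖F z‖ ^ 2) 0 r := by
        refine circleAverage_mono hmS.circleIntegrable_log_norm
          (ContinuousOn.circleIntegrable' ((hcont.norm.pow 2).const_smul (1 / 2 : ℝ))) fun z _ => ?_
        rcases (norm_nonneg (F z)).eq_or_lt with h0 | h0
        · simp [← h0]
        · have := log_le_sub_one_of_pos (pow_pos h0 2)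
          rw [log_pow] at this
          simp only [smul_eq_mul]
          push_cast at this
          linarith
      rw [circleAverage_fun_smul] at h1
      have := hS r hr0.le hr1
      simp only [smul_eq_mul] at h1
      linarith
    have hJ := MeromorphicOn.circleAverage_log_norm hr0.ne' hmer
    have hD0 : ∀ u, 0 ≤ (D u : ℝ) * log (r * ‖0 - u‖⁻¹) := by
      intro u
      by_cases hu : ‖u‖ ≤ r
      · rw [hD u hu]
        refine mul_nonneg (Nat.cast_nonneg _) ?_
        rcases eq_or_ne u 0 with rfl | h0
        · simp
        · refine log_nonneg ?_
          rw [zero_sub, norm_neg, ← div_eq_mul_inv, one_le_div (norm_pos_iff.2 h0)]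
          exact hu
      · have : D u = 0 := D.apply_eq_zero_of_notMem (by simpa [abs_of_pos hr0] using hu)
        simp [this]
    have hfin : ∑ a ∈ T, (D a : ℝ) * log (r * ‖0 - (a : ℂ)‖⁻¹)
        ≤ ∑ᶠ u, (D u : ℝ) * log (r * ‖0 - u‖⁻¹) := by
      classical
      have hDf := D.finiteSupport (isCompact_closedBall 0 |r|)
      have hsf : (Function.support fun u => (D u : ℝ) * log (r * ‖0 - u‖⁻¹))
          ⊆ (hDf.toFinset ∪ T.map (Function.Embedding.subtype _) : Finset ℂ) := by
        intro u hu
        have : D u ≠ 0 := fun h => hu (by simp [h])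
        simp [this]
      rw [finsum_eq_sum_of_support_subset _ hsf]
      calc _ = ∑ u ∈ T.map (Function.Embedding.subtype _),
            (D u : ℝ) * log (r * ‖0 - u‖⁻¹) := by simp
        _ ≤ _ := Finset.sum_le_sum_of_subset_of_nonneg Finset.subset_union_right
            fun u _ _ => hD0 u
    -- The origin contributes nothing to the sum in Jensen's formula, because `log (r * 0⁻¹) = 0`
    -- in Lean; its order `k` has to be added.
    have hterm : ∀ a ∈ T, o a * (1 - ‖(a : ℂ)‖ / r)
        ≤ (if a = ⟨0, by simp⟩ then k else 0) + D a * log (r * ‖0 - (a : ℂ)‖⁻¹) := by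
      intro a ha
      rw [hD a (hTr a ha).le]
      split_ifs with h
      · subst h
        simp [o, k]
      · have h0 : 0 < ‖(a : ℂ)‖ := norm_pos_iff.2 fun h' => h (Subtype.ext h')
        have hn : ‖0 - (a : ℂ)‖ = ‖(a : ℂ)‖ := by rw [zero_sub, norm_neg]
        rw [zero_add, hn]
        refine mul_le_mul_of_nonneg_left ?_ (Nat.cast_nonneg _)
        have := one_sub_inv_le_log_of_pos (div_pos hr0 h0)
        rwa [inv_div, div_eq_mul_inv r] at this
    have hk0 : ∑ a ∈ T, (if a = (⟨0, by simp⟩ : ball (0 : ℂ) 1) then k else 0) ≤ k := by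
      rw [Finset.sum_ite_eq']
      split_ifs
      · exact le_rfl
      · exact Nat.cast_nonneg _
    have hsum := Finset.sum_le_sum hterm
    rw [Finset.sum_add_distrib] at hsum
    have hD00 := hD 0 (by simpa using hr0.le)
    change _ = _ + (D 0 : ℝ) * log r + L at hJ
    rw [hD00] at hJ
    linarith
  have hlim1 : Tendsto (fun r : ℝ => ∑ a ∈ T, o a * (1 - ‖(a : ℂ)‖ / r)) (𝓝[<] 1)
      (𝓝 (∑ a ∈ T, o a * (1 - ‖(a : ℂ)‖ / 1))) := by
    refine tendsto_nhdsWithin_of_tendsto_nhds (ContinuousAt.tendsto ?_)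
    fun_prop (disch := norm_num)
  have hlim2 : Tendsto (fun r : ℝ => k + (S / 2 - L - k * log r)) (𝓝[<] 1)
      (𝓝 (k + (S / 2 - L - k * log 1))) := by
    refine tendsto_nhdsWithin_of_tendsto_nhds (ContinuousAt.tendsto ?_)
    fun_prop (disch := norm_num)
  simpa using le_of_tendsto_of_tendsto hlim1 hlim2 key

/-- A series of holomorphic functions on the unit disk that is dominated by a summable sequence on
each smaller disk has a holomorphic sum. -/
lemma differentiableOn_tsum_unitBall {F : ℕ → ℂ → ℂ} {u : ℝ → ℕ → ℝ}
    (hF : ∀ n, DifferentiableOn ℂ (F n) (ball 0 1))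
    (hu : ∀ r : ℝ, 0 < r → r < 1 → Summable (u r))
    (hle : ∀ r : ℝ, 0 < r → r < 1 → ∀ n z, ‖z‖ < r → ‖F n z‖ ≤ u r n) :
    DifferentiableOn ℂ (fun z => ∑' n, F n z) (ball 0 1) := by
  intro z hz
  obtain ⟨r, hzr, hr1⟩ := exists_between (mem_ball_zero_iff.1 hz)
  have hr0 : 0 < r := (norm_nonneg z).trans_lt hzr
  have h := Complex.differentiableOn_tsum_of_summable_norm (hu r hr0 hr1)
    (fun n => (hF n).mono (ball_subset_ball hr1.le)) isOpen_ball
    (fun n w hw => hle r hr0 hr1 n w (mem_ball_zero_iff.1 hw))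
  exact (h.differentiableAt (isOpen_ball.mem_nhds (mem_ball_zero_iff.2 hzr))).differentiableWithinAt

lemma differentiableOn_of_hasSum_unitBall {a : ℕ → ℂ} {f : ℂ → ℂ}
    (hf : ∀ z : ℂ, ‖z‖ < 1 → HasSum (fun n => a n * z ^ n) (f z)) :
    DifferentiableOn ℂ f (ball 0 1) := by
  refine (differentiableOn_tsum_unitBall (F := fun n z => a n * z ^ n)
    (u := fun r n => ‖a n‖ * r ^ n) (fun n => by fun_prop)
    (fun r h0 h1 => summable_norm_mul_pow hf h0.le h1) fun r _ _ n z hz => ?_).congr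
    fun z hz => (hf z (mem_ball_zero_iff.1 hz)).tsum_eq.symm
  rw [norm_mul, norm_pow]
  gcongr

/-- A holomorphic function on the disk that is not identically zero has finite order everywhere. -/
lemma analyticOrderAt_ne_top_of_unitBall {g : ℂ → ℂ} (hg : DifferentiableOn ℂ g (ball 0 1))
    {b : ℂ} (hb : b ∈ ball (0 : ℂ) 1) (hgb : g b ≠ 0) {z : ℂ} (hz : z ∈ ball (0 : ℂ) 1) :
    analyticOrderAt g z ≠ ⊤ := by
  refine (hg.analyticOnNhd isOpen_ball).analyticOrderAt_ne_top_of_isPreconnected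
    (convex_ball _ _).isPreconnected hb hz ?_
  rw [((hg.analyticOnNhd isOpen_ball) b hb).analyticOrderAt_eq_zero.2 hgb]
  simp

/-- The zeros of a function in the Hardy space of the disc satisfy the Blaschke condition. -/
lemma blaschkeZeros_of_summable_norm_sq {a : ℕ → ℂ} {F : ℂ → ℂ}
    (hF : ∀ z : ℂ, ‖z‖ < 1 → HasSum (fun n => a n * z ^ n) (F z))
    (ha : Summable fun n => ‖a n‖ ^ 2) (hne : ∃ b ∈ ball (0 : ℂ) 1, F b ≠ 0) :
    BlaschkeZeros F := by
  obtain ⟨b, hb, hFb⟩ := hne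
  have hd := differentiableOn_of_hasSum_unitBall hF
  refine blaschkeZeros_of_circleAverage_le hd
    (fun z hz => analyticOrderAt_ne_top_of_unitBall hd hb hFb hz)
    (S := ∑' n, ‖a n‖ ^ 2) fun r h0 h1 => ?_
  refine hasSum_le (fun n => ?_) (hasSum_circleAverage_norm_sq h0 (summable_norm_mul_pow hF h0 h1)
    fun z hz => hF z (hz.trans_lt h1)) ha.hasSum
  exact mul_le_of_le_one_right (by positivity) (pow_le_one₀ h0 h1.le)

/-- A divisor of a function with Blaschke zeros has Blaschke zeros. -/
lemma BlaschkeZeros.of_mul {g F : ℂ → ℂ} (hg : DifferentiableOn ℂ g (ball 0 1))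
    (hF : DifferentiableOn ℂ F (ball 0 1)) (hne : ∃ b ∈ ball (0 : ℂ) 1, g b * F b ≠ 0)
    (h : BlaschkeZeros fun z => g z * F z) : BlaschkeZeros g := by
  obtain ⟨b, hb, hgF⟩ := hne
  refine Summable.of_nonneg_of_le (fun a => ?_) (fun a => ?_) h
  · exact mul_nonneg (Nat.cast_nonneg _) (sub_nonneg.2 (mem_ball_zero_iff.1 a.2).le)
  · refine mul_le_mul_of_nonneg_right ?_ (sub_nonneg.2 (mem_ball_zero_iff.1 a.2).le)
    have hmul := analyticOrderNatAt_mul (hg.analyticOnNhd isOpen_ball a a.2)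
      (hF.analyticOnNhd isOpen_ball a a.2)
      (analyticOrderAt_ne_top_of_unitBall hg hb (left_ne_zero_of_mul hgF) a.2)
      (analyticOrderAt_ne_top_of_unitBall hF hb (right_ne_zero_of_mul hgF) a.2)
    change analyticOrderNatAt (fun z => g z * F z) a = _ at hmul
    rw [hmul]
    exact_mod_cast Nat.le_add_right _ _

/-! ### A Bergman space function whose zeros are not Blaschke -/

/-- The finite product `∏_{k < n} (1 - 2 z ^ (100 ^ k))`. Its factors have the many zeros
`|z| = 2 ^ (-1 / 100 ^ k)` near the unit circle. -/
def lacunaryProd (n : ℕ) (z : ℂ) : ℂ := ∏ k ∈ Finset.range n, (1 - 2 * z ^ 100 ^ k)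

/-- The difference of two consecutive partial products. -/
def lacunaryStep (k : ℕ) (z : ℂ) : ℂ := -2 * z ^ 100 ^ k * lacunaryProd k z

/-- The infinite product `∏ (1 - 2 z ^ (100 ^ k))` in the unit disk, written as a telescoping
series. -/
def lacunary (z : ℂ) : ℂ := 1 + ∑' k, lacunaryStep k z

lemma lacunaryProd_succ (n : ℕ) (z : ℂ) :
    lacunaryProd (n + 1) z = lacunaryProd n z + lacunaryStep n z := by
  rw [lacunaryProd, Finset.prod_range_succ, ← lacunaryProd, lacunaryStep]
  ring

lemma lacunaryProd_eq_add_sum (n : ℕ) (z : ℂ) :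
    lacunaryProd n z = 1 + ∑ k ∈ Finset.range n, lacunaryStep k z := by
  induction n with
  | zero => simp [lacunaryProd]
  | succ n ih => rw [lacunaryProd_succ, ih, Finset.sum_range_succ, add_assoc]

lemma differentiable_lacunaryProd (n : ℕ) : Differentiable ℂ (lacunaryProd n) := by
  unfold lacunaryProd
  fun_prop

lemma differentiable_lacunaryStep (n : ℕ) : Differentiable ℂ (lacunaryStep n) := by
  have := differentiable_lacunaryProd n
  unfold lacunaryStep
  fun_prop

lemma norm_lacunaryStep_le (k : ℕ) {z : ℂ} (hz : ‖z‖ ≤ 1) :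
    ‖lacunaryStep k z‖ ≤ 2 * 3 ^ k * ‖z‖ ^ 100 ^ k := by
  have hP : ‖lacunaryProd k z‖ ≤ 3 ^ k := by
    rw [lacunaryProd, norm_prod]
    refine (Finset.prod_le_prod (fun _ _ => norm_nonneg _) fun j _ => ?_).trans
      (by simp : ∏ _j ∈ Finset.range k, (3 : ℝ) ≤ 3 ^ k)
    calc ‖1 - 2 * z ^ 100 ^ j‖ ≤ ‖(1 : ℂ)‖ + ‖2 * z ^ 100 ^ j‖ := norm_sub_le _ _
      _ ≤ 1 + 2 * 1 := by
          rw [norm_one, norm_mul, norm_pow]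
          gcongr
          · simp
          · exact pow_le_one₀ (norm_nonneg z) hz
      _ = 3 := by norm_num
  rw [lacunaryStep, norm_mul, norm_mul, norm_pow]
  calc _ ≤ ‖(-2 : ℂ)‖ * ‖z‖ ^ 100 ^ k * 3 ^ k := by gcongr
    _ = _ := by simp; ring

lemma mul_pow_mul_one_sub_le_one {x : ℝ} (h0 : 0 ≤ x) (h1 : x ≤ 1) (n : ℕ) :
    n * x ^ n * (1 - x) ≤ 1 := by
  have h : n * x ^ n ≤ ∑ i ∈ Finset.range n, x ^ i := by
    simpa using Finset.card_nsmul_le_sum (Finset.range n) (fun i => x ^ i) (x ^ n) fun i hi =>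
      pow_le_pow_of_le_one h0 h1 (Finset.mem_range.1 hi).le
  calc n * x ^ n * (1 - x) ≤ (∑ i ∈ Finset.range n, x ^ i) * (1 - x) :=
        mul_le_mul_of_nonneg_right h (sub_nonneg.2 h1)
    _ = 1 - x ^ n := by rw [mul_comm, mul_neg_geom_sum]
    _ ≤ 1 := by linarith [pow_nonneg h0 n]

lemma norm_lacunaryStep_le_geometric {r : ℝ} (hr0 : 0 < r) (hr1 : r < 1) (k : ℕ) {z : ℂ}
    (hz : ‖z‖ < r) : ‖lacunaryStep k z‖ ≤ 2 / (1 - r) * (3 / 100) ^ k := by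
  have h1 : (0 : ℝ) < 1 - r := by linarith
  have h := mul_pow_mul_one_sub_le_one hr0.le hr1.le (100 ^ k)
  have h2 : r ^ 100 ^ k ≤ 1 / (100 ^ k * (1 - r)) := by
    rw [le_div_iff₀ (by positivity)]
    push_cast at h
    linarith
  calc ‖lacunaryStep k z‖ ≤ 2 * 3 ^ k * ‖z‖ ^ 100 ^ k := norm_lacunaryStep_le k (hz.trans hr1).le
    _ ≤ 2 * 3 ^ k * (1 / (100 ^ k * (1 - r))) := by
        gcongr
        exact (pow_le_pow_left₀ (norm_nonneg z) hz.le _).trans h2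
    _ = _ := by
        rw [div_pow]
        field_simp

lemma summable_two_div_mul_geometric (r : ℝ) :
    Summable fun k : ℕ => 2 / (1 - r) * (3 / 100 : ℝ) ^ k :=
  (summable_geometric_of_lt_one (by norm_num) (by norm_num)).mul_left _

lemma differentiableOn_lacunary : DifferentiableOn ℂ lacunary (ball 0 1) :=
  (differentiableOn_tsum_unitBall (fun n => (differentiable_lacunaryStep n).differentiableOn)
    (fun r _ _ => summable_two_div_mul_geometric r)
    (fun _ h0 h1 n _ hz => norm_lacunaryStep_le_geometric h0 h1 n hz)).const_add 1

open Filter Topology in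
lemma tendsto_lacunaryProd {z : ℂ} (hz : ‖z‖ < 1) :
    Tendsto (fun n => lacunaryProd n z) atTop (𝓝 (lacunary z)) := by
  obtain ⟨r, hzr, hr1⟩ := exists_between hz
  have hr0 : 0 < r := (norm_nonneg z).trans_lt hzr
  have hs : Summable fun k => lacunaryStep k z := .of_norm_bounded
    (summable_two_div_mul_geometric r) fun k => norm_lacunaryStep_le_geometric hr0 hr1 k hzr
  simp only [lacunaryProd_eq_add_sum]
  exact hs.hasSum.tendsto_sum_nat.const_add 1

lemma lacunary_zero : lacunary 0 = 1 := by
  rw [lacunary]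
  simp [lacunaryStep]

lemma lacunary_eq_zero {z : ℂ} (hz : ‖z‖ < 1) {k : ℕ} (h : z ^ 100 ^ k = 1 / 2) :
    lacunary z = 0 := by
  refine tendsto_nhds_unique (tendsto_lacunaryProd hz) (tendsto_const_nhds.congr' ?_)
  filter_upwards [Filter.eventually_gt_atTop k] with n hn
  exact (Finset.prod_eq_zero (Finset.mem_range.2 hn) (by rw [h]; norm_num)).symm

open MeasureTheory Real in
lemma eLpNorm_pow_unitBall (n : ℕ) :
    eLpNorm (fun z : ℂ => z ^ n) 2 (volume.restrict (ball 0 1))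
      = ENNReal.ofReal (√(π / (n + 1))) := by
  have h := lintegral_ball_enorm_sq (a := Pi.single n 1) (f := fun z : ℂ => z ^ n)
    (by fun_prop) fun z _ => by
      convert hasSum_single (f := fun m => (Pi.single n 1 : ℕ → ℂ) m * z ^ m) n ?_ using 1
      · simp
      · intro m hm
        simp [hm]
  rw [← eLpNorm_two_sq, tsum_eq_single n (fun m hm => by simp [hm])] at h
  refine (ENNReal.pow_right_strictMono two_ne_zero).injective ?_
  simp only [h]
  rw [← ENNReal.ofReal_pow (sqrt_nonneg _), sq_sqrt (by positivity)]
  simp [div_eq_mul_inv]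

open MeasureTheory Real in
lemma eLpNorm_lacunaryStep_le (k : ℕ) :
    eLpNorm (lacunaryStep k) 2 (volume.restrict (ball 0 1))
      ≤ ENNReal.ofReal (2 * √π * (3 / 10) ^ k) := by
  have h := eLpNorm_le_mul_eLpNorm_of_ae_le_mul (f := lacunaryStep k)
    (g := fun z : ℂ => z ^ 100 ^ k) (μ := volume.restrict (ball 0 1)) (c := 2 * 3 ^ k) (by
      filter_upwards [ae_restrict_mem measurableSet_ball] with z hz
      rw [norm_pow]
      exact norm_lacunaryStep_le k (mem_ball_zero_iff.1 hz).le) 2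
  refine h.trans ?_
  rw [eLpNorm_pow_unitBall, ← ENNReal.ofReal_mul (by positivity)]
  refine ENNReal.ofReal_le_ofReal ?_
  have h2 : √(π / ((100 ^ k : ℕ) + 1)) ≤ √π / 10 ^ k := by
    rw [sqrt_le_left (by positivity), div_pow, sq_sqrt pi_pos.le, ← pow_mul, mul_comm k, pow_mul]
    gcongr
    norm_num
  calc _ ≤ 2 * 3 ^ k * (√π / 10 ^ k) := by gcongr
    _ = _ := by rw [div_pow]; ring

open MeasureTheory Real in
lemma memBergman_lacunary : MemBergman lacunary := by
  refine ⟨differentiableOn_lacunary,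
    differentiableOn_lacunary.continuousOn.aestronglyMeasurable measurableSet_ball, ?_⟩
  have hm : ∀ n, AEStronglyMeasurable (lacunaryProd n) (volume.restrict (ball 0 1)) :=
    fun n => (differentiable_lacunaryProd n).continuous.aestronglyMeasurable
  have hm' : ∀ n, AEStronglyMeasurable (lacunaryStep n) (volume.restrict (ball 0 1)) :=
    fun n => (differentiable_lacunaryStep n).continuous.aestronglyMeasurable
  have h1 : ∀ n, eLpNorm (lacunaryProd n) 2 (volume.restrict (ball 0 1))
      ≤ ENNReal.ofReal √π + ∑ k ∈ Finset.range n, ENNReal.ofReal (2 * √π * (3 / 10) ^ k) := by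
    intro n
    induction n with
    | zero =>
      have : lacunaryProd 0 = fun z => z ^ 0 := by
        funext z
        simp [lacunaryProd]
      rw [this, eLpNorm_pow_unitBall]
      simp
    | succ n ih =>
      have : lacunaryProd (n + 1) = lacunaryProd n + lacunaryStep n :=
        funext fun z => lacunaryProd_succ n z
      rw [this, Finset.sum_range_succ, ← add_assoc]
      exact (eLpNorm_add_le (hm n) (hm' n) (by norm_num)).trans
        (add_le_add ih (eLpNorm_lacunaryStep_le n))
  have hs : Summable fun k : ℕ => 2 * √π * (3 / 10 : ℝ) ^ k :=
    (summable_geometric_of_lt_one (by norm_num) (by norm_num)).mul_left _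
  refine (Lp.eLpNorm_le_of_ae_tendsto (u := Filter.atTop) (C := ENNReal.ofReal √π +
    ∑' k : ℕ, ENNReal.ofReal (2 * √π * (3 / 10) ^ k)) (.of_forall fun n => (h1 n).trans ?_) hm
    ?_).trans_lt ?_
  · gcongr
    exact ENNReal.sum_le_tsum _
  · filter_upwards [ae_restrict_mem measurableSet_ball] with z hz
    exact tendsto_lacunaryProd (mem_ball_zero_iff.1 hz)
  · exact ENNReal.add_lt_top.2 ⟨ENNReal.ofReal_lt_top, hs.tsum_ofReal_lt_top⟩

lemma norm_eq_of_pow_eq_half {a : ℂ} {n : ℕ} (h : a ^ n = 1 / 2) : ‖a‖ ^ n = 1 / 2 := by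
  rw [← norm_pow, h]
  norm_num

lemma norm_lt_one_of_pow_eq_half {a : ℂ} {n : ℕ} (h : a ^ n = 1 / 2) : ‖a‖ < 1 := by
  by_contra! h1
  have := norm_eq_of_pow_eq_half h
  linarith [one_le_pow₀ h1 (n := n)]

/-- The zeros of the factor `1 - 2 z ^ (100 ^ k)`. -/
def lacunaryZeros (k : ℕ) : Finset ℂ := (Polynomial.nthRoots (100 ^ k) (1 / 2 : ℂ)).toFinset

lemma mem_lacunaryZeros {k : ℕ} {a : ℂ} : a ∈ lacunaryZeros k ↔ a ^ 100 ^ k = 1 / 2 := by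
  rw [lacunaryZeros, Multiset.mem_toFinset, Polynomial.mem_nthRoots (by positivity)]

lemma card_lacunaryZeros (k : ℕ) : (lacunaryZeros k).card = 100 ^ k := by
  have hp := Complex.isPrimitiveRoot_exp (100 ^ k) (by positivity)
  rw [lacunaryZeros, Multiset.toFinset_card_of_nodup (hp.nthRoots_nodup (by norm_num)),
    hp.card_nthRoots, if_pos]
  exact IsAlgClosed.exists_pow_nat_eq _ (by positivity)

lemma pairwise_disjoint_lacunaryZeros : Pairwise fun k l => Disjoint (lacunaryZeros k)
    (lacunaryZeros l) := by
  intro k l hkl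
  refine Finset.disjoint_left.2 fun a hk hl => hkl ?_
  rw [mem_lacunaryZeros] at hk hl
  have h0 : 0 < ‖a‖ := by
    rcases (norm_nonneg a).eq_or_lt with h | h
    · have := norm_eq_of_pow_eq_half hk
      rw [← h, zero_pow (by positivity)] at this
      norm_num at this
    · exact h
  have h := (pow_right_strictAnti₀ h0 (norm_lt_one_of_pow_eq_half hk)).injective
    ((norm_eq_of_pow_eq_half hk).trans (norm_eq_of_pow_eq_half hl).symm)
  exact Nat.pow_right_injective (by norm_num) h

/-- Each factor adds at least `1 / 2` to the Blaschke sum: it has `n = 100 ^ k` zeros, each of a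
modulus `x` with `1 / 2 = x ^ n ≥ 1 - n (1 - x)`. -/
lemma half_le_sum_lacunaryZeros (k : ℕ) :
    1 / 2 ≤ ∑ a ∈ lacunaryZeros k, (analyticOrderNatAt lacunary a : ℝ) * (1 - ‖a‖) := by
  have hterm : ∀ a ∈ lacunaryZeros k, (1 / 2 : ℝ) / 100 ^ k
      ≤ (analyticOrderNatAt lacunary a : ℝ) * (1 - ‖a‖) := by
    intro a ha
    rw [mem_lacunaryZeros] at ha
    have h1 := norm_lt_one_of_pow_eq_half ha
    have hmem : a ∈ ball (0 : ℂ) 1 := mem_ball_zero_iff.2 h1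
    have hA := differentiableOn_lacunary.analyticOnNhd isOpen_ball
    have hord : 1 ≤ analyticOrderNatAt lacunary a := by
      rw [Nat.one_le_iff_ne_zero]
      intro h0
      have h2 := Nat.cast_analyticOrderNatAt (analyticOrderAt_ne_top_of_unitBall
        differentiableOn_lacunary (b := 0) (by simp) (by simp [lacunary_zero]) hmem)
      rw [h0, Nat.cast_zero, eq_comm, (hA a hmem).analyticOrderAt_eq_zero] at h2
      exact h2 (lacunary_eq_zero h1 ha)
    have hB := one_add_mul_le_pow (a := ‖a‖ - 1) (by linarith [norm_nonneg a]) (100 ^ k)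
    rw [add_sub_cancel, norm_eq_of_pow_eq_half ha] at hB
    push_cast at hB
    calc (1 / 2 : ℝ) / 100 ^ k ≤ 1 * (1 - ‖a‖) := by
          rw [div_le_iff₀ (by positivity)]
          linarith
      _ ≤ _ := by
          refine mul_le_mul_of_nonneg_right ?_ (by linarith)
          exact_mod_cast hord
  have := Finset.card_nsmul_le_sum _ _ _ hterm
  rw [card_lacunaryZeros, nsmul_eq_mul] at this
  push_cast at this
  rwa [mul_div_cancel₀ _ (by positivity)] at this

lemma not_blaschkeZeros_lacunary : ¬ BlaschkeZeros lacunary := by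
  intro h
  let φ : ℂ → ℝ := fun a => (analyticOrderNatAt lacunary a : ℝ) * (1 - ‖a‖)
  have hs : Summable ((ball (0 : ℂ) 1).indicator φ) := summable_subtype_iff_indicator.1 h
  have hb : ∀ K : ℕ, (K : ℝ) * (1 / 2) ≤ ∑' a, (ball (0 : ℂ) 1).indicator φ a := by
    intro K
    have hlb : (K : ℝ) * (1 / 2) ≤ ∑ k ∈ Finset.range K, ∑ a ∈ lacunaryZeros k, φ a := by
      simpa using Finset.card_nsmul_le_sum (Finset.range K) _ (1 / 2 : ℝ)
        fun k _ => half_le_sum_lacunaryZeros k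
    rw [← Finset.sum_biUnion fun k _ l _ hkl => pairwise_disjoint_lacunaryZeros hkl] at hlb
    refine hlb.trans (le_trans (le_of_eq (Finset.sum_congr rfl fun a ha => ?_))
      (hs.sum_le_tsum _ fun a _ => Set.indicator_nonneg (fun a ha => ?_) a))
    · obtain ⟨k, -, hk⟩ := Finset.mem_biUnion.1 ha
      exact (Set.indicator_of_mem (mem_ball_zero_iff.2
        (norm_lt_one_of_pow_eq_half (mem_lacunaryZeros.1 hk))) φ).symm
    · exact mul_nonneg (Nat.cast_nonneg _) (sub_nonneg.2 (mem_ball_zero_iff.1 ha).le)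
  obtain ⟨K, hK⟩ := exists_nat_gt ((∑' a, (ball (0 : ℂ) 1).indicator φ a) * 2)
  linarith [hb K]

/-! ### Elements of the Drury–Arveson space -/

namespace DruryArveson2

/-- The element of `H²_2` with a given square-summable family of coordinates. -/
def ofCoeff (c : ℕ × ℕ → ℂ) (hc : Summable fun p => ‖c p‖ ^ 2) : DruryArveson2 :=
  (⟨c, memℓp_gen (by simpa using hc)⟩ : ℓ²(ℕ × ℕ, ℂ))

lemma coeff_ofCoeff (c : ℕ × ℕ → ℂ) (hc : Summable fun p => ‖c p‖ ^ 2) (p : ℕ × ℕ) :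
    (ofCoeff c hc).coeff p = c p := rfl

/-- The basis function of index `p` as an element of `H²_2`. -/
def basisVec (p : ℕ × ℕ) : DruryArveson2 := (lp.single 2 p (1 : ℂ) : ℓ²(ℕ × ℕ, ℂ))

lemma coeff_basisVec (p q : ℕ × ℕ) : (basisVec p).coeff q = if q = p then 1 else 0 := by
  change (lp.single 2 p (1 : ℂ) : ℓ²(ℕ × ℕ, ℂ)) q = _
  rw [lp.single_apply, Pi.single_apply]

lemma basisVec_apply (p : ℕ × ℕ) (z : UnitBall2) : basisVec p z = basisFun p z := by
  refine (hasSum_apply (basisVec p) z).unique ?_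
  convert hasSum_single p ?_ using 1
  · simp [coeff_basisVec]
  · intro q hq
    simp [coeff_basisVec, hq]

lemma hasSum_basisVec (f : DruryArveson2) : HasSum (fun p => f.coeff p • basisVec p) f := by
  have h := lp.hasSum_single (p := 2) (by norm_num) f.toL2
  have e : (fun p => f.coeff p • basisVec p)
      = fun p => (lp.single 2 p (f.toL2 p) : ℓ²(ℕ × ℕ, ℂ)) := by
    funext p
    change f.coeff p • (lp.single 2 p (1 : ℂ) : ℓ²(ℕ × ℕ, ℂ)) = _
    rw [← lp.single_smul, smul_eq_mul, mul_one]
    rfl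
  rw [e]
  exact h

/-- The first coordinate function is a multiplier: multiplication by it maps the basis function of
index `(m, n)` to a multiple, by a factor of at most one, of that of index `(m + 1, n)`. -/
lemma isMultiplier_coord_zero : IsMultiplier DruryArveson2 fun z : UnitBall2 => z.1 0 := by
  intro f
  let i : ℕ × ℕ → ℕ × ℕ := fun p => (p.1 + 1, p.2)
  have hi : Function.Injective i := fun p q h => by
    simp only [i, Prod.mk.injEq, add_left_inj] at h
    exact Prod.ext h.1 h.2
  let N : ℕ × ℕ → ℝ := fun p => ((p.1 + p.2).choose p.1 : ℝ)
  have hN : ∀ p, 0 < N p := fun p => by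
    simpa [N] using Nat.choose_pos (Nat.le_add_right p.1 p.2)
  have hNi : ∀ p, N p ≤ N (i p) := fun p => by
    simp only [N, i]
    have : p.1 + 1 + p.2 = (p.1 + p.2) + 1 := by ring
    rw [this, Nat.choose_succ_succ]
    push_cast
    linarith [(Nat.cast_nonneg ((p.1 + p.2).choose (p.1 + 1)) : (0 : ℝ) ≤ _)]
  let c : ℕ × ℕ → ℂ := fun p => f.coeff p * ((Real.sqrt (N p) / Real.sqrt (N (i p)) : ℝ) : ℂ)
  have hc : Summable fun p => ‖c p‖ ^ 2 := by
    refine .of_nonneg_of_le (fun p => by positivity) (fun p => ?_) (hasSum_norm_sq f).summable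
    refine pow_le_pow_left₀ (norm_nonneg _) ?_ 2
    rw [norm_mul, Complex.norm_real, Real.norm_of_nonneg (by positivity)]
    exact mul_le_of_le_one_right (norm_nonneg _)
      (div_le_one_of_le₀ (Real.sqrt_le_sqrt (hNi p)) (Real.sqrt_nonneg _))
  have hd : Summable fun p => ‖Function.extend i c 0 p‖ ^ 2 := by
    rw [← hi.summable_iff]
    · refine hc.congr fun p => ?_
      simp [hi.extend_apply]
    · intro p hp
      rw [Function.extend_apply' _ _ _ hp]
      simp
  refine ⟨ofCoeff _ hd, fun z => ?_⟩
  have h := hasSum_apply (ofCoeff _ hd) z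
  simp only [coeff_ofCoeff] at h
  rw [← hi.hasSum_iff] at h
  · refine h.unique ?_
    refine ((hasSum_apply f z).mul_left (z.1 0)).congr_fun fun p => ?_
    have hn : (Real.sqrt (N (i p)) : ℂ) ≠ 0 := by
      exact_mod_cast (Real.sqrt_pos.2 ((hN p).trans_le (hNi p))).ne'
    have hb : basisFun (i p) z = (Real.sqrt (N (i p)) : ℂ) * (z.1 0 ^ (p.1 + 1) * z.1 1 ^ p.2) :=
      rfl
    have hb' : basisFun p z = (Real.sqrt (N p) : ℂ) * (z.1 0 ^ p.1 * z.1 1 ^ p.2) := rfl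
    simp only [Function.comp_apply, hi.extend_apply, hb, hb', c, Complex.ofReal_div]
    field_simp
    ring
  · intro p hp
    rw [Function.extend_apply' _ _ _ hp]
    simp

lemma basisFun_col_one (m : ℕ) (z : UnitBall2) :
    basisFun (m, 1) z = (Real.sqrt (m + 1) : ℂ) * (z.1 0 ^ m * z.1 1) := by
  simp [basisFun]

/-- A closed invariant subspace that contains `z₂` contains all `z₁ᵐ z₂`. -/
lemma basisVec_col_one_mem {M : Submodule ℂ DruryArveson2} (hM : IsMultInvariant M)
    (h : basisVec (0, 1) ∈ M) (m : ℕ) : basisVec (m, 1) ∈ M := by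
  induction m with
  | zero => exact h
  | succ m ih =>
    have h1 : (Real.sqrt (m + 1) : ℂ) ≠ 0 := by
      exact_mod_cast (Real.sqrt_pos.2 (by positivity : (0 : ℝ) < m + 1)).ne'
    have h2 : (Real.sqrt ((m + 1 : ℕ) + 1) : ℂ) ≠ 0 := by
      exact_mod_cast (Real.sqrt_pos.2 (by positivity : (0 : ℝ) < (m + 1 : ℕ) + 1)).ne'
    have hs : ((Real.sqrt (m + 1) : ℂ) / (Real.sqrt ((m + 1 : ℕ) + 1) : ℂ)) • basisVec (m + 1, 1)
        ∈ M := by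
      refine hM _ isMultiplier_coord_zero _ ih _ fun z => ?_
      rw [RKHS.coe_smul, Pi.smul_apply, basisVec_apply, basisVec_apply, basisFun_col_one,
        basisFun_col_one, smul_eq_mul]
      field_simp
      ring
    exact (M.smul_mem_iff (div_ne_zero h1 h2)).1 hs

/-- `[z₂]` contains every function in `H²_2` of the form `z₂ u(z₁)`. -/
lemma mem_multInvariantSpan_basisVec {f : DruryArveson2}
    (hf : ∀ p : ℕ × ℕ, p.2 ≠ 1 → f.coeff p = 0) : f ∈ multInvariantSpan (basisVec (0, 1)) := by
  rw [multInvariantSpan, Submodule.mem_sInf]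
  rintro M ⟨hcl, hinv, hmem⟩
  refine hcl.mem_of_tendsto (hasSum_basisVec f) (.of_forall fun s => M.sum_mem fun p _ => ?_)
  obtain ⟨m, n⟩ := p
  by_cases hn : n = 1
  · subst hn
    exact M.smul_mem _ (basisVec_col_one_mem hinv hmem m)
  · rw [hf _ hn, zero_smul]
    exact M.zero_mem

/-- The point `(w, 0)` of the ball. -/
def discPoint (w : ball (0 : ℂ) 1) : UnitBall2 :=
  ⟨!₂[(w : ℂ), 0], by
    rw [mem_ball_zero_iff, EuclideanSpace.norm_eq, Real.sqrt_lt' one_pos]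
    have := mem_ball_zero_iff.1 w.2
    simp only [Fin.sum_univ_two, Matrix.cons_val_zero, Matrix.cons_val_one, one_pow]
    simpa using this⟩

/-- The restriction of `f` to the disc `z₂ = 0` has the power series with coefficients
`f.coeff (m, 0)`; so it belongs to the Hardy space of the disc. -/
lemma hasSum_discPoint (f : DruryArveson2) (w : ball (0 : ℂ) 1) :
    HasSum (fun m => f.coeff (m, 0) * (w : ℂ) ^ m) (f (discPoint w)) := by
  have h := hasSum_apply f (discPoint w)
  have hi : Function.Injective fun m : ℕ => (m, 0) := fun m n h => (Prod.ext_iff.1 h).1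
  rw [← hi.hasSum_iff] at h
  · refine h.congr_fun fun m => ?_
    simp [basisFun, discPoint]
  · rintro ⟨m, n⟩ hp
    have hn : n ≠ 0 := fun h => hp ⟨m, by simp [h]⟩
    simp [basisFun, discPoint, hn]

lemma summable_coeff_row_zero (f : DruryArveson2) : Summable fun m : ℕ => ‖f.coeff (m, 0)‖ ^ 2 :=
  (hasSum_norm_sq f).summable.comp_injective
    (i := fun m : ℕ => (m, 0)) fun _ _ h => (Prod.ext_iff.1 h).1

end DruryArveson2

/-! ### The domain of multiplication by a function of the first coordinate -/

open DruryArveson2 in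
/-- Functions in the domain of multiplication by `g(z₁)` vanish on the disc `z₂ = 0`, in particular
at the origin, if the zeros of `g` are not Blaschke. -/
lemma apply_discPoint_eq_zero_of_mem_multiplicationDomain {g : ℂ → ℂ} {φ : UnitBall2 → ℂ}
    (hg : DifferentiableOn ℂ g (ball 0 1)) (hne : ∃ a ∈ ball (0 : ℂ) 1, g a ≠ 0)
    (hB : ¬ BlaschkeZeros g) (hφ : ∀ z, φ z = g (z.1 0)) {f : DruryArveson2}
    (hf : f ∈ multiplicationDomain DruryArveson2 φ) (w : ball (0 : ℂ) 1) :
    f (discPoint w) = 0 := by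
  obtain ⟨k, hk⟩ := hf
  by_contra hfw
  let F : ℂ → ℂ := fun z => ∑' m, f.coeff (m, 0) * z ^ m
  have hFs : ∀ z (hz : ‖z‖ < 1), F z = f (discPoint ⟨z, mem_ball_zero_iff.2 hz⟩) :=
    fun z hz => (hasSum_discPoint f ⟨z, mem_ball_zero_iff.2 hz⟩).tsum_eq
  have hF : ∀ z : ℂ, ‖z‖ < 1 → HasSum (fun m => f.coeff (m, 0) * z ^ m) (F z) := fun z hz => by
    rw [hFs z hz]
    exact hasSum_discPoint f ⟨z, mem_ball_zero_iff.2 hz⟩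
  have hgF : ∀ z : ℂ, ‖z‖ < 1 → HasSum (fun m => k.coeff (m, 0) * z ^ m) (g z * F z) := by
    intro z hz
    have h := hasSum_discPoint k ⟨z, mem_ball_zero_iff.2 hz⟩
    rw [hk, hφ, ← hFs z hz] at h
    simpa [discPoint] using h
  have hFd := differentiableOn_of_hasSum_unitBall hF
  have hprod : ∃ b ∈ ball (0 : ℂ) 1, g b * F b ≠ 0 := by
    obtain ⟨a, ha, hga⟩ := hne
    by_contra! h0
    have hFw : F w ≠ 0 := by
      rw [hFs w (mem_ball_zero_iff.1 w.2)]
      exact hfw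
    rcases AnalyticOnNhd.eq_zero_or_eq_zero_of_mul_eq_zero (hg.analyticOnNhd isOpen_ball)
      (hFd.analyticOnNhd isOpen_ball) h0 (convex_ball _ _).isPreconnected with h | h
    · exact hga (h a ha)
    · exact hFw (h w w.2)
  exact hB ((blaschkeZeros_of_summable_norm_sq hgF (summable_coeff_row_zero k) hprod).of_mul
    hg hFd hprod)

end

open DruryArveson2

theorem mainTheorem12 :
    (∃ g : ℂ → ℂ, MemBergman g ∧ (∃ a ∈ ball (0 : ℂ) 1, g a ≠ 0) ∧ ¬ BlaschkeZeros g) ∧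
    ∀ g : ℂ → ℂ, MemBergman g → (∃ a ∈ ball (0 : ℂ) 1, g a ≠ 0) → ¬ BlaschkeZeros g →
      ∃ (f₁ f₂ : DruryArveson2) (h : EuclideanSpace ℂ (Fin 2) → ℂ),
        (∀ z : UnitBall2, f₁ z = z.1 1 * g (z.1 0)) ∧
        (∀ z : UnitBall2, f₂ z = z.1 1) ∧
        f₁ ∈ multInvariantSpan f₂ ∧
        DifferentiableOn ℂ h (ball 0 1) ∧
        (∀ z : UnitBall2, f₂ z ≠ 0 → h z.1 = f₁ z / f₂ z) ∧
        ¬ Dense (multiplicationDomain DruryArveson2 (fun z : UnitBall2 => h z.1)) := by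
  refine ⟨⟨lacunary, memBergman_lacunary, ⟨0, by simp, by simp [lacunary_zero]⟩,
    not_blaschkeZeros_lacunary⟩, fun g hg hne hB => ?_⟩
  obtain ⟨a, ha, hsum⟩ := hg.exists_hasSum
  have hcoord : ∀ z ∈ ball (0 : EuclideanSpace ℂ (Fin 2)) 1, z 0 ∈ ball (0 : ℂ) 1 := fun z hz =>
    mem_ball_zero_iff.2 ((PiLp.norm_apply_le z 0).trans_lt (mem_ball_zero_iff.1 hz))
  have hi : Function.Injective fun m : ℕ => (m, 1) := fun m n h => (Prod.ext_iff.1 h).1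
  -- The coordinates of `z₂ g(z₁)`: the function `z₁ᵐ z₂` has norm `1 / √(m + 1)`.
  let c : ℕ × ℕ → ℂ := fun p => if p.2 = 1 then a p.1 / (Real.sqrt (p.1 + 1) : ℂ) else 0
  have hc : Summable fun p => ‖c p‖ ^ 2 := by
    rw [← hi.summable_iff]
    · refine hsum.congr fun m => ?_
      have : (0 : ℝ) ≤ m + 1 := by positivity
      simp [c, div_pow, Real.sq_sqrt this]
    · rintro ⟨m, n⟩ hp
      have hn : n ≠ 1 := fun h => hp ⟨m, by simp [h]⟩
      simp [c, hn]
  have hf₁ : ∀ z : UnitBall2, ofCoeff c hc z = z.1 1 * g (z.1 0) := by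
    intro z
    have h := hasSum_apply (ofCoeff c hc) z
    simp only [coeff_ofCoeff] at h
    rw [← hi.hasSum_iff] at h
    · refine h.unique (((ha _ (mem_ball_zero_iff.1 (hcoord _ z.2))).mul_left (z.1 1)).congr_fun
        fun m => ?_)
      have h1 : (Real.sqrt (m + 1) : ℂ) ≠ 0 := by
        exact_mod_cast (Real.sqrt_pos.2 (by positivity : (0 : ℝ) < m + 1)).ne'
      simp only [Function.comp_apply, basisFun_col_one, c, if_true]
      field_simp
    · rintro ⟨m, n⟩ hp
      have hn : n ≠ 1 := fun h => hp ⟨m, by simp [h]⟩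
      simp [c, hn]
  have hf₂ : ∀ z : UnitBall2, basisVec (0, 1) z = z.1 1 := fun z => by
    rw [basisVec_apply, basisFun_col_one]
    simp
  refine ⟨ofCoeff c hc, basisVec (0, 1), fun z => g (z 0), hf₁, hf₂, ?_, ?_, fun z hz => ?_, ?_⟩
  · refine mem_multInvariantSpan_basisVec fun p hp => ?_
    rw [coeff_ofCoeff]
    exact if_neg hp
  · exact hg.1.comp (by fun_prop) hcoord
  · rw [hf₂] at hz
    rw [hf₁, hf₂, mul_div_cancel_left₀ _ hz]
  · intro hd
    have hcl : IsClosed {f : DruryArveson2 | f (discPoint ⟨0, by simp⟩) = 0} :=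
      isClosed_singleton.preimage (RKHS.continuous_eval (discPoint ⟨0, by simp⟩))
    have hsub := hcl.closure_subset_iff.2 fun f hf =>
      apply_discPoint_eq_zero_of_mem_multiplicationDomain hg.1 hne hB (fun _ => rfl) hf ⟨0, by simp⟩
    have h1 : basisVec (0, 0) (discPoint ⟨0, by simp⟩) = 0 := hsub (hd (basisVec (0, 0)))
    rw [basisVec_apply] at h1
    simp [basisFun] at h1
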